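/- Let $p$ be a prime and let $\mathbb C$ be a complete, non-archimedean, algebraically closed field of characteristic $0$ whose residue field has characteristic $p$. Let $\mathcal O$ be its ring of integers, $\mathcal O^\flat=\varprojlim_{x\mapsto x^p}\mathcal O/p\mathcal O$ its tilt, with maximal ideal $\mathfrak m^\flat$, and $\mathbb A_{\mathrm{inf}}=W(\mathcal O^\flat)$ the ring of $p$-typical Witt vectors, so that $\mathbb A_{\mathrm{inf}}/p\mathbb A_{\mathrm{inf}}=\mathcal O^\flat$. Call an $\mathbb A_{\mathrm{inf}}$-module perfect if it admits a finite length resolution by finite free $\mathbb A_{\mathrm{inf}}$-modules. Then: (ii) If $M$ is a finitely presented $\mathbb A_{\mathrm{inf}}$-module such that $M[\tfrac1p]$ is finite free over $\mathbb A_{\mathrm{inf}}[\tfrac1p]$, then $M$ is perfect. (iii) For finitely presented $\mathbb A_{\mathrm{inf}}$-modules $M$ such that $M[\tfrac1p]$ is finite free over $\mathbb A_{\mathrm{inf}}[\tfrac1p]$, there is an exact sequence of $\mathbb A_{\mathrm{inf}}$-modules, functorial in $M$, \[0\longrightarrow M_{\mathrm{tor}}\longrightarrow M\longrightarrow M_{\mathrm{free}}\longrightarrow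 \overline M\longrightarrow 0,\] such that: $M_{\mathrm{tor}}$ is a perfect $\mathbb A_{\mathrm{inf}}$-module killed by a power of $p$; $M_{\mathrm{free}}$ is a finite free $\mathbb A_{\mathrm{inf}}$-module; and $\overline M$ is a perfect $\mathbb A_{\mathrm{inf}}$-module which, for every $t\in\mathbb A_{\mathrm{inf}}$ whose image in $\mathcal O^\flat$ lies in $\mathfrak m^\flat\setminus\{0\}$, is killed by a power of the ideal $\langle p,t\rangle$. (iv) Finite projective modules over $\mathbb A_{\mathrm{inf}}[\tfrac1p]$ are finite free. -/

import Mathlib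

universe u v w

open CategoryTheory

/-- The ring of integers `𝒪 = {x | ‖x‖ ≤ 1}` of a non-archimedean field `C`. -/
noncomputable abbrev IntegerRing (C : Type u) [NormedField C] [IsUltrametricDist C] :
    ValuationSubring C :=
  (NormedField.valuation (K := C)).valuationSubring

/-- If the residue field of `C` has characteristic `p`, then `p` is not a unit in `𝒪`
(Mathlib's construction of the tilt asks for this). -/
instance IntegerRing.fact_not_isUnit (p : ℕ) (C : Type u) [NormedField C] [IsUltrametricDist C]
    [CharP (IsLocalRing.ResidueField (IntegerRing C)) p] :
    Fact (¬ IsUnit (p : IntegerRing C)) :=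
  ⟨fun h => by
    have h1 := h.map (IsLocalRing.residue (IntegerRing C))
    rw [map_natCast, CharP.cast_eq_zero] at h1
    exact not_isUnit_zero h1⟩

section Ainf

variable (p : ℕ) [Fact p.Prime] (C : Type u) [NormedField C] [IsUltrametricDist C]
  [CharP (IsLocalRing.ResidueField (IntegerRing C)) p]

/-- The tilt `𝒪♭ = lim 𝒪/p` of the ring of integers, the limit being along Frobenius. -/
abbrev TiltRing : Type u := PreTilt (IntegerRing C) p

/-- Fontaine's infinitesimal period ring `𝔸_inf = W(𝒪♭)`. -/
abbrev Ainf : Type u := WittVector p (TiltRing p C)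

/-- The localisation `𝔸_inf[1/p]`. -/
abbrev AinfInvP : Type u := Localization.Away (p : Ainf p C)

end Ainf

/-- An `A`-module `M` is perfect if it has a finite length resolution
`0 → A^(r n) → ⋯ → A^(r 1) → A^(r 0) → M → 0` by finite free `A`-modules. -/
def IsPerfectModule (A : Type u) [CommRing A] (M : Type v) [AddCommGroup M] [Module A M] : Prop :=
  ∃ (n : ℕ) (r : ℕ → ℕ) (d : ∀ i, (Fin (r (i + 1)) → A) →ₗ[A] (Fin (r i) → A))
    (ε : (Fin (r 0) → A) →ₗ[A] M),
    (∀ i, n < i → r i = 0) ∧ Function.Surjective ε ∧ Function.Exact (d 0) ε ∧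
      ∀ i, Function.Exact (d (i + 1)) (d i)

/-- The full subcategory of those `A`-modules `M` which are finitely presented and for which
`M[1/a]` is finite free over `A[1/a]`. -/
def IsFinPresFreeAway (A : Type u) [CommRing A] (a : A) :
    ObjectProperty (ModuleCat.{w} A) := fun M =>
  Module.FinitePresentation A M ∧
    Module.Finite (Localization.Away a) (LocalizedModule (Submonoid.powers a) M) ∧
    Module.Free (Localization.Away a) (LocalizedModule (Submonoid.powers a) M)

/-!
Write `A = 𝔸_inf`. It is `p`-adically separated with `p` in its Jacobson radical, and `A ⧸ (p) = 𝒪♭`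
is a valuation ring, since divisibility in `𝒪♭` is divisibility of untilts in `𝒪`. Nothing else
about `A` matters for perfectness and freeness.

Finite torsion-free modules over a valuation ring are free, so a finite `p`-torsion-free `A`-module
`Q` is free as soon as `Q ⧸ pQ` is torsion-free over `A ⧸ (p)`. Likewise a finite `A`-module killed
by a power of `p` is finitely presented if the elements of `A` not divisible by `p` act injectively
on it; hence many kernels are finitely generated although `A` is not known to be coherent.

Let `M` be finitely presented with `M[1/p]` free. A basis of `M[1/p]` spans a free lattice, and
comparison with it shows that the image of `M` in `M[1/p]` is finitely presented, which makes `M`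
and `M_tor` perfect. The module `M_free` is the saturation of this image by the elements of `A` not
divisible by `p`. The quotient `M_free ⧸ M` is killed by a power of `p` and by a single `s` with
`p ∤ s`; since `s` divides a power of `t` modulo `p`, it is killed by a power of `(p, t)`.

A finite projective `A[1/p]`-module is a direct summand of some `A[1/p]^d`, and meets `A^d` in a
lattice which is free for the same reasons.
-/

section FreeResolutions

variable {A : Type u} [CommRing A] {M : Type v} [AddCommGroup M] [Module A M]

theorem IsPerfectModule.of_surjective_of_ker {s : ℕ} (f : (Fin s → A) →ₗ[A] M)
    (hf : Function.Surjective f) (h : IsPerfectModule A (LinearMap.ker f)) :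
    IsPerfectModule A M := by
  obtain ⟨n, r, d, ε, hr, hε, hd₀, hd⟩ := h
  let r' : ℕ → ℕ := fun i => i.casesOn s r
  let d' : ∀ i, (Fin (r' (i + 1)) → A) →ₗ[A] (Fin (r' i) → A) := fun i =>
    match i with
    | 0 => (LinearMap.ker f).subtype ∘ₗ ε
    | i + 1 => d i
  refine ⟨n + 1, r', d', f, ?_, hf, ?_, ?_⟩
  · rintro (_ | i) hi
    · omega
    · exact hr i (by omega)
  · rw [LinearMap.exact_iff, LinearMap.range_comp, LinearMap.range_eq_top.2 hε,
      Submodule.map_top, Submodule.range_subtype]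
  · rintro (_ | i)
    · exact hd₀.comp_injective _ (Submodule.subtype_injective _) (map_zero _)
    · exact hd i

theorem IsPerfectModule.of_subsingleton [Subsingleton M] : IsPerfectModule A M :=
  ⟨0, fun _ => 0, fun _ => 0, 0, fun _ _ => rfl, fun _ => ⟨0, Subsingleton.elim _ _⟩,
    fun _ => ⟨fun _ => ⟨0, Subsingleton.elim _ _⟩, fun _ => Subsingleton.elim _ _⟩,
    fun _ _ => ⟨fun _ => ⟨0, Subsingleton.elim _ _⟩, fun _ => Subsingleton.elim _ _⟩⟩

theorem IsPerfectModule.of_free [Module.Finite A M] [Module.Free A M] : IsPerfectModule A M := by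
  let e := ((Module.Free.chooseBasis A M).reindex (Fintype.equivFin _)).equivFun.symm
  have : Subsingleton (LinearMap.ker e.toLinearMap) :=
    Submodule.subsingleton_iff_eq_bot.2 (LinearEquiv.ker e)
  exact .of_surjective_of_ker e.toLinearMap e.surjective .of_subsingleton

end FreeResolutions

section ValuativePrime

open Pointwise

variable {A : Type u} [CommRing A] {p : A}

/-- A prime element `p` of `A` is valuative if `A` is `p`-adically separated, `p` lies in the
Jacobson radical and the domain `A ⧸ (p)` is a valuation ring: this is all that the arguments below
retain of the element `p` of `𝔸_inf`. -/
structure IsValuativePrime (p : A) : Prop where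
  prime : Prime p
  mem_jacobson_bot : p ∈ (⊥ : Ideal A).jacobson
  isHausdorff : IsHausdorff (Ideal.span {p}) A
  preValuationRing : PreValuationRing (A ⧸ Ideal.span {p})

/-- The elements of `A` not divisible by `p` act on `Q` without torsion. For a prime `p`, this is
torsion-freeness over `A ⧸ (p)` when `Q` is killed by `p`. -/
def IsTorsionFreeOutside (p : A) (Q : Type*) [AddCommGroup Q] [Module A Q] : Prop :=
  ∀ s : A, ¬ p ∣ s → IsSMulRegular Q s

theorem IsTorsionFreeOutside.of_injective {Q Q' : Type*} [AddCommGroup Q] [Module A Q]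
    [AddCommGroup Q'] [Module A Q'] (h : IsTorsionFreeOutside p Q') (f : Q →ₗ[A] Q')
    (hf : Function.Injective f) : IsTorsionFreeOutside p Q :=
  fun s hs => (h s hs).of_injective f hf

theorem isTorsionFreeOutside_quotient_iff {Q : Type*} [AddCommGroup Q] [Module A Q]
    {N : Submodule A Q} :
    IsTorsionFreeOutside p (Q ⧸ N) ↔ ∀ s, ¬ p ∣ s → ∀ x, s • x ∈ N → x ∈ N :=
  forall₂_congr fun s _ => isSMulRegular_quotient_iff_mem_of_smul_mem N s

theorem isTorsionFreeOutside_quotSMulTop_iff {Q : Type*} [AddCommGroup Q] [Module A Q] {a : A} :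
    IsTorsionFreeOutside p (QuotSMulTop a Q) ↔
      ∀ s, ¬ p ∣ s → ∀ x y : Q, s • x = a • y → ∃ z, x = a • z := by
  simp only [isTorsionFreeOutside_quotient_iff, Submodule.mem_smul_pointwise_iff_exists,
    Submodule.mem_top, true_and, forall_exists_index, eq_comm]

theorem mem_smul_top_of_forall_dvd_repr {F ι : Type*} [AddCommGroup F] [Module A F]
    (b : Module.Basis ι A F) {c : A} {x : F} (h : ∀ i, c ∣ b.repr x i) :
    x ∈ c • (⊤ : Submodule A F) := by
  rw [← b.linearCombination_repr x, Finsupp.linearCombination_apply]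
  refine Submodule.sum_mem _ fun i _ => ?_
  obtain ⟨d, hd⟩ := h i
  simp only [hd, mul_smul]
  exact Submodule.smul_mem_pointwise_smul _ _ _ trivial

theorem isTorsionFreeOutside_quotSMulTop_pow [IsDomain A] (hp : Prime p) (F : Type*)
    [AddCommGroup F] [Module A F] [Module.Free A F] (n : ℕ) :
    IsTorsionFreeOutside p (QuotSMulTop (p ^ n) F) := by
  let b := Module.Free.chooseBasis A F
  refine isTorsionFreeOutside_quotient_iff.2 fun s hs x hx => ?_
  obtain ⟨y, -, hy⟩ := Submodule.mem_smul_pointwise_iff_exists .. |>.1 hx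
  refine mem_smul_top_of_forall_dvd_repr b fun i =>
    hp.pow_dvd_of_dvd_mul_left n hs ⟨b.repr y i, ?_⟩
  simpa using congrArg (b.repr · i) hy.symm

theorem eq_bot_of_le_smul_of_free [IsHausdorff (Ideal.span {p}) A] {F : Type*} [AddCommGroup F]
    [Module A F] [Module.Free A F] {K : Submodule A F} (hK : K ≤ p • K) : K = ⊥ := by
  have hpow : ∀ n : ℕ, K ≤ p ^ n • K := fun n => by
    induction n with
    | zero => simp
    | succ n ih => exact hK.trans ((smul_mono_right p ih).trans_eq (by rw [smul_smul, pow_succ']))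
  let b := Module.Free.chooseBasis A F
  refine (Submodule.eq_bot_iff K).2 fun x hx => b.ext_elem fun i => ?_
  rw [map_zero, Finsupp.zero_apply]
  refine IsHausdorff.haus ‹_› _ fun n => ?_
  obtain ⟨y, -, hy⟩ := Submodule.mem_smul_pointwise_iff_exists .. |>.1 (hpow n hx)
  rw [SModEq.zero, smul_eq_mul, Ideal.mul_top, Ideal.span_singleton_pow,
    Ideal.mem_span_singleton, ← hy]
  exact ⟨b.repr y i, by simp⟩

theorem free_of_free_quotSMulTop [IsHausdorff (Ideal.span {p}) A]
    (hpJ : p ∈ (⊥ : Ideal A).jacobson) {Q : Type*} [AddCommGroup Q] [Module A Q]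
    [Module.Finite A Q] (hQ : IsSMulRegular Q p)
    [Module.Free (A ⧸ Ideal.span {p}) (QuotSMulTop p Q)] : Module.Free A Q := by
  let π := (p • (⊤ : Submodule A Q)).mkQ
  let b := Module.Free.chooseBasis (A ⧸ Ideal.span {p}) (QuotSMulTop p Q)
  choose v hv using fun i => Submodule.mkQ_surjective (p • (⊤ : Submodule A Q)) (b i)
  let g := Finsupp.linearCombination A v
  have hπg (c) : π (g c) = b.repr.symm (c.mapRange (Ideal.Quotient.mk _) (map_zero _)) := by
    rw [b.repr_symm_apply, Finsupp.linearCombination_apply, Finsupp.linearCombination_apply,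
      Finsupp.sum_mapRange_index fun i => zero_smul (A ⧸ Ideal.span {p}) (b i), map_finsuppSum]
    exact Finsupp.sum_congr fun i _ => (map_smul π _ _).trans (congrArg _ (hv i))
  have hsurj : LinearMap.range g = ⊤ := by
    refine top_le_iff.1 (Submodule.le_of_le_smul_of_le_jacobson_bot Module.Finite.fg_top
      ((Ideal.span_singleton_le_iff_mem _).2 hpJ) fun x _ => ?_)
    obtain ⟨c, hc⟩ := Finsupp.mapRange_surjective (Ideal.Quotient.mk (Ideal.span {p}))
      (map_zero _) Ideal.Quotient.mk_surjective (b.repr (π x))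
    have hx : x - g c ∈ p • (⊤ : Submodule A Q) := by
      refine (Submodule.Quotient.eq _).1 (Eq.symm ?_)
      exact (hπg c).trans (by rw [hc, LinearEquiv.symm_apply_apply]; rfl)
    rw [← add_sub_cancel (g c) x, Submodule.ideal_span_singleton_smul]
    exact Submodule.add_mem_sup ⟨c, rfl⟩ hx
  have hker : LinearMap.ker g ≤ p • LinearMap.ker g := fun c hc => by
    have hmk : c.mapRange (Ideal.Quotient.mk (Ideal.span {p})) (map_zero _) = 0 :=
      b.repr.symm.injective (by rw [← hπg, LinearMap.mem_ker.1 hc, map_zero, map_zero])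
    obtain ⟨d, -, rfl⟩ := Submodule.mem_smul_pointwise_iff_exists .. |>.1 <|
      mem_smul_top_of_forall_dvd_repr (x := c) Finsupp.basisSingleOne fun i =>
        Ideal.mem_span_singleton.1 <| Ideal.Quotient.eq_zero_iff_mem.1 (DFunLike.congr_fun hmk i)
    exact Submodule.smul_mem_pointwise_smul _ _ _
      (hQ.right_eq_zero_of_smul ((map_smul g p d).symm.trans hc))
  exact .of_equiv (LinearEquiv.ofBijective g
    ⟨LinearMap.ker_eq_bot.1 (eq_bot_of_le_smul_of_free hker), LinearMap.range_eq_top.1 hsurj⟩)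

namespace IsValuativePrime

variable {Q : Type v} [AddCommGroup Q] [Module A Q]

theorem free_quotient [Module.Finite A Q] (hp : IsValuativePrime p)
    [Module (A ⧸ Ideal.span {p}) Q] [IsScalarTower A (A ⧸ Ideal.span {p}) Q]
    (hQ : IsTorsionFreeOutside p Q) : Module.Free (A ⧸ Ideal.span {p}) Q := by
  have : IsDomain (A ⧸ Ideal.span {p}) := (Ideal.Quotient.isDomain_iff_prime _).2
    ((Ideal.span_singleton_prime hp.prime.ne_zero).2 hp.prime)
  have : ValuationRing (A ⧸ Ideal.span {p}) := { hp.preValuationRing with }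
  have : Module.Finite (A ⧸ Ideal.span {p}) Q := .of_restrictScalars_finite A _ _
  have : Module.Flat (A ⧸ Ideal.span {p}) Q := by
    rw [Module.Flat.flat_iff_torsion_eq_bot_of_isBezout, eq_bot_iff]
    rintro x ⟨⟨s, hs⟩, hsx⟩
    obtain ⟨s, rfl⟩ := Ideal.Quotient.mk_surjective s
    have hps : ¬ p ∣ s := fun h => nonZeroDivisors.ne_zero hs
      (Ideal.Quotient.eq_zero_iff_mem.2 (Ideal.mem_span_singleton.2 h))
    exact (hQ s hps).right_eq_zero_of_smul
      ((algebraMap_smul (A ⧸ Ideal.span {p}) s x).symm.trans hsx)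
  exact Module.free_of_flat_of_isLocalRing

theorem free (hp : IsValuativePrime p) [Module.Finite A Q] (hQ : IsSMulRegular Q p)
    (hQp : IsTorsionFreeOutside p (QuotSMulTop p Q)) : Module.Free A Q := by
  have := hp.isHausdorff
  have := hp.free_quotient hQp
  exact free_of_free_quotSMulTop hp.mem_jacobson_bot hQ

theorem finitePresentation_of_smul_eq_zero (hp : IsValuativePrime p) [Module.Finite A Q]
    (hpQ : ∀ x : Q, p • x = 0) (hQ : IsTorsionFreeOutside p Q) :
    Module.FinitePresentation A Q := by
  have hT : Module.IsTorsionBySet A Q (Ideal.span {p}) :=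
    (Module.isTorsionBySet_span_singleton_iff p).2 hpQ
  let _ := hT.module
  have : IsScalarTower A (A ⧸ Ideal.span {p}) Q := hT.isScalarTower
  have := hp.free_quotient hQ
  have : Module.Finite (A ⧸ Ideal.span {p}) Q := .of_restrictScalars_finite A _ _
  have : Module.FinitePresentation (A ⧸ Ideal.span {p}) Q :=
    Module.finitePresentation_of_projective _ _
  have : Module.FinitePresentation A (A ⧸ Ideal.span {p}) := by
    refine Module.finitePresentation_of_surjective (Ideal.span {p}).mkQ
      (Submodule.mkQ_surjective _) ?_
    rw [Submodule.ker_mkQ]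
    exact Submodule.fg_span_singleton p
  exact Module.FinitePresentation.trans A Q (A ⧸ Ideal.span {p})

theorem finitePresentation_of_pow_smul_eq_zero (hp : IsValuativePrime p) [Module.Finite A Q]
    {n : ℕ} (hpQ : ∀ x : Q, p ^ n • x = 0) (hQ : IsTorsionFreeOutside p Q) :
    Module.FinitePresentation A Q := by
  induction n generalizing Q with
  | zero =>
    have : Subsingleton Q := subsingleton_of_forall_eq 0 fun x => by simpa using hpQ x
    infer_instance
  | succ n ih =>
    let φ := LinearMap.lsmul A Q (p ^ n)
    have : Module.FinitePresentation A (LinearMap.range φ) := by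
      refine hp.finitePresentation_of_smul_eq_zero ?_
        (hQ.of_injective _ (Submodule.subtype_injective _))
      rintro ⟨_, x, rfl⟩
      exact Subtype.ext (by simpa [φ, smul_smul, ← pow_succ'] using hpQ x)
    have hker := Module.FinitePresentation.fg_ker _ φ.surjective_rangeRestrict
    have := Module.Finite.iff_fg.2 hker
    have : Module.FinitePresentation A (LinearMap.ker φ.rangeRestrict) :=
      ih (fun x => Subtype.ext (congrArg Subtype.val (LinearMap.mem_ker.1 x.2) :))
        (hQ.of_injective _ (Submodule.subtype_injective _))
    exact Module.finitePresentation_of_ker _ φ.surjective_rangeRestrict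

theorem fg_inf_ker (hp : IsValuativePrime p) {M : Type*} [AddCommGroup M] [Module A M]
    (hQ : IsTorsionFreeOutside p Q) {P : Submodule A M} (hP : P.FG) (g : M →ₗ[A] Q) {n : ℕ}
    (hg : ∀ x ∈ P, p ^ n • g x = 0) : (P ⊓ LinearMap.ker g).FG := by
  have := Module.Finite.iff_fg.2 hP
  have : Module.FinitePresentation A (LinearMap.range (g.domRestrict P)) :=
    hp.finitePresentation_of_pow_smul_eq_zero (n := n)
      (by rintro ⟨_, x, rfl⟩; exact Subtype.ext (hg x x.2))
      (hQ.of_injective _ (Submodule.subtype_injective _))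
  have hker := Module.FinitePresentation.fg_ker _ (g.domRestrict P).surjective_rangeRestrict
  rw [LinearMap.ker_rangeRestrict, LinearMap.ker_domRestrict] at hker
  exact Submodule.map_comap_subtype P _ ▸ hker.map P.subtype

variable [IsDomain A] {F : Type*} [AddCommGroup F] [Module A F] [Module.Finite A F]
  [Module.Free A F]

theorem finitePresentation_of_injective (hp : IsValuativePrime p) [Module.Finite A Q]
    (g : Q →ₗ[A] F) (hg : Function.Injective g) {n : ℕ}
    (hF : ∀ x, p ^ n • x ∈ LinearMap.range g) : Module.FinitePresentation A Q := by
  let e := LinearEquiv.ofInjective g hg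
  let h : F →ₗ[A] Q := e.symm ∘ₗ (LinearMap.lsmul A F (p ^ n)).codRestrict _ hF
  have hgh : ∀ x, g (h x) = p ^ n • x := fun x =>
    congrArg Subtype.val (e.apply_symm_apply ⟨p ^ n • x, hF x⟩)
  have hh : Function.Injective h := fun x y hxy =>
    (IsSMulRegular.of_ne_zero (pow_ne_zero n hp.prime.ne_zero)) <| by
      simpa only [hgh] using congrArg g hxy
  have hker : Module.FinitePresentation A (LinearMap.ker (LinearMap.range h).mkQ) := by
    rw [Submodule.ker_mkQ]
    have := Module.finitePresentation_of_projective A F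
    exact .of_equiv (LinearEquiv.ofInjective h hh)
  have : Module.FinitePresentation A (Q ⧸ LinearMap.range h) := by
    refine hp.finitePresentation_of_pow_smul_eq_zero (n := n) (fun x => ?_)
      (isTorsionFreeOutside_quotient_iff.2 ?_)
    · obtain ⟨x, rfl⟩ := Submodule.mkQ_surjective _ x
      exact (Submodule.Quotient.mk_eq_zero _).2 ⟨g x, hg (by rw [hgh, map_smul])⟩
    · rintro s hs x ⟨y, hy⟩
      obtain ⟨w, hw⟩ := isTorsionFreeOutside_quotSMulTop_iff.1
        (isTorsionFreeOutside_quotSMulTop_pow hp.prime F n) s hs (g x) y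
        (by rw [← map_smul, ← hy, hgh])
      exact ⟨w, hg (by rw [hgh, hw])⟩
  exact Module.finitePresentation_of_ker _ (Submodule.mkQ_surjective (LinearMap.range h))

theorem free_ker (hp : IsValuativePrime p) [Module.FinitePresentation A Q]
    (hQ : IsSMulRegular Q p) (f : F →ₗ[A] Q) (hf : Function.Surjective f) :
    Module.Free A (LinearMap.ker f) := by
  have := Module.Finite.iff_fg.2 (Module.FinitePresentation.fg_ker f hf)
  refine hp.free (.submodule _ _ (.of_ne_zero hp.prime.ne_zero))
    (isTorsionFreeOutside_quotSMulTop_iff.2 fun s hs x y hxy => ?_)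
  obtain ⟨z, hz⟩ := isTorsionFreeOutside_quotSMulTop_iff.1
    (isTorsionFreeOutside_quotSMulTop_pow hp.prime F 1) s hs x y
    (by rw [pow_one]; exact congrArg Subtype.val hxy)
  rw [pow_one] at hz
  have hfz : f z = 0 := hQ.right_eq_zero_of_smul (by rw [← map_smul, ← hz, LinearMap.mem_ker.1 x.2])
  exact ⟨⟨z, hfz⟩, Subtype.ext hz⟩

theorem isPerfectModule_of_isSMulRegular (hp : IsValuativePrime p) [Module.FinitePresentation A Q]
    (hQ : IsSMulRegular Q p) : IsPerfectModule A Q := by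
  obtain ⟨r, f, hf⟩ := Module.Finite.exists_fin' A Q
  have := Module.Finite.iff_fg.2 (Module.FinitePresentation.fg_ker f hf)
  have := hp.free_ker hQ f hf
  exact .of_surjective_of_ker f hf .of_free

theorem isPerfectModule_of_finitePresentation_ker (hp : IsValuativePrime p) {r : ℕ}
    (f : (Fin r → A) →ₗ[A] Q) (hf : Function.Surjective f)
    [Module.FinitePresentation A (LinearMap.ker f)] : IsPerfectModule A Q :=
  .of_surjective_of_ker f hf <| hp.isPerfectModule_of_isSMulRegular <|
    IsSMulRegular.submodule _ _ (IsSMulRegular.of_ne_zero hp.prime.ne_zero)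

variable {M : Type*} [AddCommGroup M] [Module A M] [Module.FinitePresentation A M]

theorem finitePresentation_ker (hp : IsValuativePrime p) [Module.FinitePresentation A Q]
    (hQ : IsSMulRegular Q p) (h : M →ₗ[A] Q) (hh : Function.Surjective h) :
    Module.FinitePresentation A (LinearMap.ker h) := by
  obtain ⟨r, g, hg⟩ := Module.Finite.exists_fin' A M
  have hhg : Function.Surjective (h ∘ₗ g) := hh.comp hg
  have := hp.free_ker hQ (h ∘ₗ g) hhg
  have := Module.Finite.iff_fg.2 (Module.FinitePresentation.fg_ker (h ∘ₗ g) hhg)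
  have := Module.Finite.iff_fg.2 (Module.FinitePresentation.fg_ker g hg)
  have := Module.finitePresentation_of_projective A (LinearMap.ker (h ∘ₗ g))
  let g' : LinearMap.ker (h ∘ₗ g) →ₗ[A] LinearMap.ker h := g.restrict fun _ hx => hx
  refine Module.finitePresentation_of_surjective g' ?_ ?_
  · rintro ⟨x, hx⟩
    obtain ⟨y, rfl⟩ := hg x
    exact ⟨⟨y, hx⟩, rfl⟩
  · have hker : LinearMap.ker g' = (LinearMap.ker g).submoduleOf (LinearMap.ker (h ∘ₗ g)) :=
      Submodule.ext fun x => Subtype.ext_iff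
    rw [hker, ← Module.Finite.iff_fg]
    exact .equiv (Submodule.submoduleOfEquivOfLe (LinearMap.ker_le_ker_comp g h)).symm

theorem isPerfectModule_of_pow_smul_ker_eq_zero (hp : IsValuativePrime p)
    [Module.FinitePresentation A Q] (hQ : IsSMulRegular Q p) (h : M →ₗ[A] Q)
    (hh : Function.Surjective h) {n : ℕ} (hker : ∀ x, h x = 0 → p ^ n • x = 0) :
    IsPerfectModule A M := by
  obtain ⟨r, g, hg⟩ := Module.Finite.exists_fin' A M
  have hhg : Function.Surjective (h ∘ₗ g) := hh.comp hg
  have := hp.free_ker hQ (h ∘ₗ g) hhg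
  have := Module.Finite.iff_fg.2 (Module.FinitePresentation.fg_ker (h ∘ₗ g) hhg)
  have := Module.Finite.iff_fg.2 (Module.FinitePresentation.fg_ker g hg)
  have hle := LinearMap.ker_le_ker_comp g h
  have : Module.FinitePresentation A (LinearMap.ker g) :=
    hp.finitePresentation_of_injective (n := n) _ (Submodule.inclusion_injective hle) fun x => by
      rw [Submodule.range_inclusion, Submodule.mem_comap, LinearMap.mem_ker, map_smul, map_smul]
      exact hker _ x.2
  exact hp.isPerfectModule_of_finitePresentation_ker g hg

theorem isPerfectModule_of_pow_smul_eq_zero (hp : IsValuativePrime p) {n : ℕ}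
    (hM : ∀ x : M, p ^ n • x = 0) : IsPerfectModule A M :=
  hp.isPerfectModule_of_pow_smul_ker_eq_zero (Q := PUnit.{1})
    (Function.injective_of_subsingleton _) 0 (Function.surjective_to_subsingleton _) fun x _ => hM x

end IsValuativePrime

end ValuativePrime

section Lattices

variable {A : Type u} [CommRing A]

theorem exists_forall_smul_mem_of_fg (S : Submonoid A) {L : Type*} [AddCommGroup L] [Module A L]
    {N P : Submodule A L} (hN : N.FG) (h : ∀ x ∈ N, ∃ s ∈ S, s • x ∈ P) :
    ∃ s ∈ S, ∀ x ∈ N, s • x ∈ P := by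
  induction N, hN using Submodule.fg_induction with
  | singleton x =>
    obtain ⟨s, hs, hx⟩ := h x (Submodule.mem_span_singleton_self x)
    refine ⟨s, hs, fun y hy => ?_⟩
    obtain ⟨a, rfl⟩ := Submodule.mem_span_singleton.1 hy
    exact smul_comm a s x ▸ P.smul_mem a hx
  | sup N₁ N₂ _ _ h₁ h₂ =>
    obtain ⟨s, hs, h₁⟩ := h₁ fun x hx => h x (Submodule.mem_sup_left hx)
    obtain ⟨t, ht, h₂⟩ := h₂ fun x hx => h x (Submodule.mem_sup_right hx)
    refine ⟨s * t, S.mul_mem hs ht, fun x hx => ?_⟩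
    obtain ⟨y, hy, z, hz, rfl⟩ := Submodule.mem_sup.1 hx
    rw [smul_add]
    exact P.add_mem (by rw [mul_comm, mul_smul]; exact P.smul_mem t (h₁ y hy))
      (by rw [mul_smul]; exact P.smul_mem s (h₂ z hz))

theorem exists_forall_pow_smul_mem_of_fg {p : A} {L : Type*} [AddCommGroup L] [Module A L]
    {N P : Submodule A L} (hN : N.FG) (h : ∀ x ∈ N, ∃ n : ℕ, p ^ n • x ∈ P) :
    ∃ n : ℕ, ∀ x ∈ N, p ^ n • x ∈ P := by
  obtain ⟨_, ⟨n, rfl⟩, hn⟩ := exists_forall_smul_mem_of_fg (Submonoid.powers p) hN fun x hx =>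
    let ⟨n, hn⟩ := h x hx
    ⟨p ^ n, ⟨n, rfl⟩, hn⟩
  exact ⟨n, hn⟩

section Saturation

variable {p : A} {L : Type*} [AddCommGroup L] [Module A L] (hp : Prime p)

/-- The saturation of `N` away from the prime element `p`: the elements with a multiple in `N` by a
scalar not divisible by `p`. It is the smallest submodule containing `N` whose quotient is
torsion-free outside `p`. -/
def saturationOutside (N : Submodule A L) : Submodule A L where
  carrier := {x | ∃ s : A, ¬ p ∣ s ∧ s • x ∈ N}
  zero_mem' := ⟨1, hp.not_dvd_one, by simp⟩
  add_mem' := by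
    rintro x y ⟨s, hs, hx⟩ ⟨t, ht, hy⟩
    refine ⟨s * t, hp.not_dvd_mul hs ht, ?_⟩
    rw [smul_add, mul_smul, smul_comm, mul_smul]
    exact N.add_mem (N.smul_mem t hx) (N.smul_mem s hy)
  smul_mem' := by
    rintro a x ⟨s, hs, hx⟩
    exact ⟨s, hs, smul_comm a s x ▸ N.smul_mem a hx⟩

theorem le_saturationOutside (N : Submodule A L) : N ≤ saturationOutside hp N :=
  fun x hx => ⟨1, hp.not_dvd_one, by simpa using hx⟩

theorem isTorsionFreeOutside_quotient_saturationOutside (N : Submodule A L) :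
    IsTorsionFreeOutside p (L ⧸ saturationOutside hp N) := by
  refine isTorsionFreeOutside_quotient_iff.2 fun s hs x ⟨t, ht, hx⟩ => ?_
  exact ⟨t * s, hp.not_dvd_mul ht hs, mul_smul t s x ▸ hx⟩

theorem saturationOutside_le {N P : Submodule A L} (hNP : N ≤ P)
    (hP : IsTorsionFreeOutside p (L ⧸ P)) : saturationOutside hp N ≤ P :=
  fun x ⟨s, hs, hx⟩ => isTorsionFreeOutside_quotient_iff.1 hP s hs x (hNP hx)

theorem exists_forall_smul_mem_of_saturationOutside {N : Submodule A L}
    (h : (saturationOutside hp N).FG) :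
    ∃ s, ¬ p ∣ s ∧ ∀ x ∈ saturationOutside hp N, s • x ∈ N := by
  have := (Ideal.span_singleton_prime hp.ne_zero).2 hp
  obtain ⟨s, hs, hsN⟩ := exists_forall_smul_mem_of_fg (Ideal.span {p}).primeCompl h
    fun x ⟨s, hs, hx⟩ => ⟨s, fun h => hs (Ideal.mem_span_singleton.1 h), hx⟩
  exact ⟨s, fun h => hs (Ideal.mem_span_singleton.2 h), hsN⟩

end Saturation

/-- A submodule `P` of an `A[1/p]`-module `L` is a free lattice if it is finite free over `A` and
`P[1/p] = L`. -/
structure IsFreeLattice (p : A) {L : Type*} [AddCommGroup L] [Module A L] (P : Submodule A L) :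
    Prop where
  finite : Module.Finite A P
  free : Module.Free A P
  exists_pow_smul_mem : ∀ x, ∃ n : ℕ, p ^ n • x ∈ P

variable {p : A} {L : Type v} [AddCommGroup L] [Module A L]

theorem IsFreeLattice.isTorsionFreeOutside_quotient [IsDomain A] {P : Submodule A L}
    (hP : IsFreeLattice p P) (hp : Prime p) (hL : IsSMulRegular L p) :
    IsTorsionFreeOutside p (L ⧸ P) := by
  refine isTorsionFreeOutside_quotient_iff.2 fun s hs x hx => ?_
  have := hP.free
  obtain ⟨n, hn⟩ := hP.exists_pow_smul_mem x
  obtain ⟨w, hw⟩ := isTorsionFreeOutside_quotSMulTop_iff.1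
    (isTorsionFreeOutside_quotSMulTop_pow hp P n) s hs ⟨_, hn⟩ ⟨_, hx⟩
    (Subtype.ext (smul_comm s (p ^ n) x))
  rw [hL.pow n (congrArg Subtype.val hw :)]
  exact w.2

theorem IsFreeLattice.exists_ge {P : Submodule A L} (hP : IsFreeLattice p P)
    (hL : IsUnit (algebraMap A (Module.End A L) p)) {N : Submodule A L} (hN : N.FG) :
    ∃ P', IsFreeLattice p P' ∧ N ≤ P' := by
  obtain ⟨k, hk⟩ := exists_forall_pow_smul_mem_of_fg hN fun x _ => hP.exists_pow_smul_mem x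
  let e : L ≃ₗ[A] L := .ofBijective (algebraMap A (Module.End A L) (p ^ k))
    ((Module.End.isUnit_iff _).1 (by rw [map_pow]; exact hL.pow k))
  have := hP.finite
  have := hP.free
  refine ⟨P.map e.symm.toLinearMap, ⟨.equiv (e.symm.submoduleMap P),
    .of_equiv (e.symm.submoduleMap P), fun x => ?_⟩, fun x hx => ?_⟩
  · obtain ⟨n, hn⟩ := hP.exists_pow_smul_mem x
    refine ⟨n, (Submodule.mem_map_equiv _).2 ?_⟩
    change p ^ k • p ^ n • x ∈ P
    exact P.smul_mem _ hn
  · exact (Submodule.mem_map_equiv _).2 (hk x hx)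

theorem IsValuativePrime.free_of_isTorsionFreeOutside_quotient (hp : IsValuativePrime p)
    (hL : IsUnit (algebraMap A (Module.End A L) p)) (P : Submodule A L) [Module.Finite A P]
    (hP : IsTorsionFreeOutside p (L ⧸ P)) : Module.Free A P := by
  obtain ⟨hreg, hsurj⟩ := (Module.End.isUnit_iff _).1 hL
  refine hp.free (.submodule _ _ hreg) (isTorsionFreeOutside_quotSMulTop_iff.2 fun s hs x y h => ?_)
  obtain ⟨z, hz : p • z = x⟩ := hsurj x
  have hsz : s • z = y := hreg <| by
    change p • s • z = p • (y : L)
    rw [smul_comm, hz]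
    exact congrArg Subtype.val h
  exact ⟨⟨z, isTorsionFreeOutside_quotient_iff.1 hP s hs z (hsz ▸ y.2)⟩, Subtype.ext hz.symm⟩

section Away

theorem isUnit_algebraMap_end_of_away (p : A) (B : Type w) [CommRing B] [Algebra A B]
    [IsLocalization.Away p B] (L : Type v) [AddCommGroup L] [Module A L] [Module B L]
    [IsScalarTower A B L] : IsUnit (algebraMap A (Module.End A L) p) := by
  have h := (IsLocalization.Away.algebraMap_isUnit (S := B) p).map (Algebra.lsmul A A L)
  rwa [AlgHom.commutes] at h

theorem isFreeLattice_span_range_basis [IsDomain A] {B : Type w} [CommRing B] [Algebra A B]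
    [IsLocalization.Away p B] [Module B L] [IsScalarTower A B L] (hp : p ≠ 0) {ι : Type*} [Finite ι]
    (b : Module.Basis ι B L) : IsFreeLattice p (Submodule.span A (Set.range b)) := by
  have hle := powers_le_nonZeroDivisors_of_noZeroDivisors hp
  have : IsDomain B := IsLocalization.isDomain_of_le_nonZeroDivisors B hle
  have : Module.IsTorsionFree A B :=
    Module.isTorsionFree_iff_algebraMap_injective.2 (IsLocalization.injective B hle)
  refine ⟨.of_basis (b.restrictScalars A), .of_basis (b.restrictScalars A), fun x => ?_⟩
  obtain ⟨⟨_, n, rfl⟩, h⟩ :=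
    IsLocalization.exist_integer_multiples_of_finite (Submonoid.powers p) (b.repr x)
  refine ⟨n, (b.mem_span_iff_repr_mem A _).2 fun i => ?_⟩
  obtain ⟨a, ha⟩ := h i
  exact ⟨a, ha.trans (DFunLike.congr_fun (map_smul (b.repr.restrictScalars A) (p ^ n) x) i).symm⟩

theorem IsFreeLattice.isLocalizedModule {P : Submodule A L} (hP : IsFreeLattice p P)
    (hL : IsUnit (algebraMap A (Module.End A L) p)) :
    IsLocalizedModule (Submonoid.powers p) P.subtype :=
  IsLocalizedModule.Away.mk_of_addCommGroup hL (fun x =>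
    let ⟨n, hn⟩ := hP.exists_pow_smul_mem x
    ⟨n, ⟨_, hn⟩, rfl⟩)
    fun x hx => ⟨0, by simpa using hx⟩

namespace IsValuativePrime

theorem exists_isFreeLattice [IsDomain A] (hp : IsValuativePrime p) (B : Type w) [CommRing B]
    [Algebra A B] [IsLocalization.Away p B] (L : Type v) [AddCommGroup L] [Module A L] [Module B L]
    [IsScalarTower A B L] [Module.Finite B L] [Module.Projective B L] :
    ∃ P : Submodule A L, IsFreeLattice p P := by
  obtain ⟨d, π, hπ⟩ := Module.Finite.exists_fin' B L
  obtain ⟨i, hi⟩ := Module.projective_lifting_property π LinearMap.id hπ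
  replace hi : ∀ x, π (i x) = x := LinearMap.congr_fun hi
  let π' := π.restrictScalars A
  let i' := i.restrictScalars A
  let F := Submodule.span A (Set.range (Pi.basisFun B (Fin d)))
  have hF : IsFreeLattice p F := isFreeLattice_span_range_basis hp.prime.ne_zero _
  have hBd := isUnit_algebraMap_end_of_away p B (Fin d → B)
  have hQ : IsTorsionFreeOutside p ((Fin d → B) ⧸ F) :=
    hF.isTorsionFreeOutside_quotient hp.prime ((Module.End.isUnit_iff _).1 hBd).1
  have hFfg := Module.Finite.iff_fg.1 hF.finite
  obtain ⟨k, hk⟩ := exists_forall_pow_smul_mem_of_fg ((hFfg.map π').map i')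
    fun x _ => hF.exists_pow_smul_mem x
  have hcomap : F.map π' ⊓ LinearMap.ker (F.mkQ ∘ₗ i') = F.comap i' := by
    rw [LinearMap.ker_comp, Submodule.ker_mkQ]
    exact inf_eq_right.2 fun x hx => ⟨i' x, hx, hi x⟩
  have : Module.Finite A (F.comap i') := Module.Finite.iff_fg.2 <| hcomap ▸
    hp.fg_inf_ker hQ (hFfg.map π') (F.mkQ ∘ₗ i') fun x hx =>
      (Submodule.Quotient.mk_eq_zero _).2 (hk _ ⟨x, hx, rfl⟩)
  refine ⟨F.comap i', inferInstance, hp.free_of_isTorsionFreeOutside_quotient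
    (isUnit_algebraMap_end_of_away p B L) _ (isTorsionFreeOutside_quotient_iff.2
      fun s hs x hx => ?_), fun x => ?_⟩
  · exact isTorsionFreeOutside_quotient_iff.1 hQ s hs (i' x) (map_smul i' s x ▸ hx)
  · obtain ⟨n, hn⟩ := hF.exists_pow_smul_mem (i' x)
    exact ⟨n, by rwa [Submodule.mem_comap, map_smul]⟩

theorem exists_isFreeLattice_localizedModule [IsDomain A] (hp : IsValuativePrime p) (M : Type v)
    [AddCommGroup M] [Module A M]
    [Module.Finite (Localization.Away p) (LocalizedModule (Submonoid.powers p) M)]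
    [Module.Free (Localization.Away p) (LocalizedModule (Submonoid.powers p) M)] :
    ∃ P : Submodule A (LocalizedModule (Submonoid.powers p) M), IsFreeLattice p P :=
  hp.exists_isFreeLattice (Localization.Away p) _

theorem free_of_projective_away [IsDomain A] (hp : IsValuativePrime p) (B : Type w) [CommRing B]
    [Algebra A B] [IsLocalization.Away p B] (L : Type v) [AddCommGroup L] [Module B L]
    [Module.Finite B L] [Module.Projective B L] : Module.Free B L := by
  let _ : Module A L := Module.compHom L (algebraMap A B)
  have : IsScalarTower A B L := .of_algebraMap_smul fun _ _ => rfl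
  obtain ⟨P, hP⟩ := hp.exists_isFreeLattice B L
  have := hP.free
  have := hP.isLocalizedModule (isUnit_algebraMap_end_of_away p B L)
  exact Module.free_of_isLocalizedModule (Submonoid.powers p) P.subtype

end IsValuativePrime

end Away

section TorsionFreeSequence

variable {M : Type*} [AddCommGroup M] [Module A M]

/-- A linear map `f`, as a map to the saturation of its range. For `f : M → M[1/p]` this is the map
`M → M_free`. -/
def toSaturationOutside (hp : Prime p) (f : M →ₗ[A] L) :
    M →ₗ[A] saturationOutside hp (LinearMap.range f) :=
  f.codRestrict _ fun x => le_saturationOutside hp _ ⟨x, rfl⟩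

theorem ker_toSaturationOutside (hp : Prime p) (f : M →ₗ[A] L) :
    LinearMap.ker (toSaturationOutside hp f) = LinearMap.ker f :=
  LinearMap.ker_codRestrict _ _ _

theorem smul_mkQ_range_toSaturationOutside_eq_zero (hp : Prime p) (f : M →ₗ[A] L) {s : A}
    (h : ∀ x ∈ saturationOutside hp (LinearMap.range f), s • x ∈ LinearMap.range f)
    (x : saturationOutside hp (LinearMap.range f) ⧸ LinearMap.range (toSaturationOutside hp f)) :
    s • x = 0 := by
  obtain ⟨x, rfl⟩ := Submodule.mkQ_surjective _ x
  obtain ⟨y, hy⟩ := h x x.2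
  exact (Submodule.Quotient.mk_eq_zero _).2 ⟨y, Subtype.ext hy⟩

theorem IsFreeLattice.exists_ge_range {P : Submodule A L} (hP : IsFreeLattice p P)
    [Module.Finite A M] (f : M →ₗ[A] L) [IsLocalizedModule (Submonoid.powers p) f] :
    ∃ P', IsFreeLattice p P' ∧ LinearMap.range f ≤ P' ∧
      ∃ n : ℕ, ∀ x ∈ P', p ^ n • x ∈ LinearMap.range f := by
  obtain ⟨P', hP', hle⟩ := hP.exists_ge (IsLocalizedModule.Away.isUnit_algebraMap f p)
    (Module.Finite.iff_fg.1 (Module.Finite.range f))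
  refine ⟨P', hP', hle, exists_forall_pow_smul_mem_of_fg (Module.Finite.iff_fg.1 hP'.finite) ?_⟩
  exact fun x _ => let ⟨n, y, h⟩ := IsLocalizedModule.Away.surj f p x; ⟨n, y, h.symm⟩

namespace IsValuativePrime

variable [IsDomain A] {P : Submodule A L} (f : M →ₗ[A] L) [IsLocalizedModule (Submonoid.powers p) f]

section Finite

variable [Module.Finite A M]

theorem finitePresentation_range (hp : IsValuativePrime p) (hP : IsFreeLattice p P) :
    Module.FinitePresentation A (LinearMap.range f) := by
  obtain ⟨P', hP', hle, n, hn⟩ := hP.exists_ge_range f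
  have := hP'.finite
  have := hP'.free
  refine hp.finitePresentation_of_injective (n := n) _ (Submodule.inclusion_injective hle)
    fun x => ?_
  rw [Submodule.range_inclusion]
  exact hn x x.2

theorem finite_saturationOutside_range (hp : IsValuativePrime p) (hP : IsFreeLattice p P) :
    Module.Finite A (saturationOutside hp.prime (LinearMap.range f)) := by
  obtain ⟨P', hP', hle, n, hn⟩ := hP.exists_ge_range f
  have hL := (Module.End.isUnit_iff _).1 (IsLocalizedModule.Away.isUnit_algebraMap f p)
  have hsat := saturationOutside_le hp.prime hle
    (hP'.isTorsionFreeOutside_quotient hp.prime hL.1)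
  have hfg := hp.fg_inf_ker (isTorsionFreeOutside_quotient_saturationOutside hp.prime _)
    (Module.Finite.iff_fg.1 hP'.finite) (Submodule.mkQ _) fun x hx =>
      (Submodule.Quotient.mk_eq_zero _).2 (le_saturationOutside hp.prime _ (hn x hx))
  rwa [Submodule.ker_mkQ, inf_eq_right.2 hsat, ← Module.Finite.iff_fg] at hfg

theorem free_saturationOutside_range (hp : IsValuativePrime p) (hP : IsFreeLattice p P) :
    Module.Free A (saturationOutside hp.prime (LinearMap.range f)) := by
  have := hp.finite_saturationOutside_range f hP
  exact hp.free_of_isTorsionFreeOutside_quotient (IsLocalizedModule.Away.isUnit_algebraMap f p) _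
    (isTorsionFreeOutside_quotient_saturationOutside hp.prime _)

theorem exists_pow_smul_mem_range_of_saturationOutside (hp : IsValuativePrime p)
    (hP : IsFreeLattice p P) : ∃ n : ℕ,
      ∀ x ∈ saturationOutside hp.prime (LinearMap.range f), p ^ n • x ∈ LinearMap.range f := by
  have := hp.finite_saturationOutside_range f hP
  refine exists_forall_pow_smul_mem_of_fg (Module.Finite.iff_fg.1 this) fun x _ => ?_
  obtain ⟨n, y, h⟩ := IsLocalizedModule.Away.surj f p x
  exact ⟨n, y, h.symm⟩

theorem isPerfectModule_quotient_range_toSaturationOutside (hp : IsValuativePrime p)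
    (hP : IsFreeLattice p P) : IsPerfectModule A
      (saturationOutside hp.prime (LinearMap.range f) ⧸
        LinearMap.range (toSaturationOutside hp.prime f)) := by
  have := hp.finite_saturationOutside_range f hP
  have := hp.free_saturationOutside_range f hP
  have := Module.finitePresentation_of_projective A
    (saturationOutside hp.prime (LinearMap.range f))
  have : Module.FinitePresentation A (_ ⧸ LinearMap.range (toSaturationOutside hp.prime f)) := by
    refine Module.finitePresentation_of_surjective _ (Submodule.mkQ_surjective _) ?_
    rw [Submodule.ker_mkQ]
    exact Module.Finite.iff_fg.1 (Module.Finite.range _)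
  obtain ⟨n, hn⟩ := hp.exists_pow_smul_mem_range_of_saturationOutside f hP
  exact hp.isPerfectModule_of_pow_smul_eq_zero
    (smul_mkQ_range_toSaturationOutside_eq_zero hp.prime f hn)

theorem exists_span_pow_le_annihilator_quotient (hp : IsValuativePrime p)
    (hP : IsFreeLattice p P) {t : A} (ht : ∀ s, ¬ p ∣ s → t ∈ (Ideal.span {p, s}).radical) :
    ∃ n : ℕ, Ideal.span {p, t} ^ n ≤ Module.annihilator A
      (saturationOutside hp.prime (LinearMap.range f) ⧸
        LinearMap.range (toSaturationOutside hp.prime f)) := by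
  obtain ⟨m, hm⟩ := hp.exists_pow_smul_mem_range_of_saturationOutside f hP
  obtain ⟨s, hs, hsf⟩ := exists_forall_smul_mem_of_saturationOutside hp.prime
    (Module.Finite.iff_fg.1 (hp.finite_saturationOutside_range f hP))
  set I := Module.annihilator A (saturationOutside hp.prime (LinearMap.range f) ⧸
    LinearMap.range (toSaturationOutside hp.prime f))
  have hpI : p ∈ I.radical := ⟨m, Module.mem_annihilator.2
    (smul_mkQ_range_toSaturationOutside_eq_zero hp.prime f hm)⟩
  have hsI : s ∈ I.radical := Ideal.le_radical <| Module.mem_annihilator.2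
    (smul_mkQ_range_toSaturationOutside_eq_zero hp.prime f hsf)
  have htI : t ∈ I.radical := Ideal.radical_le_radical_iff.2
    (Ideal.span_le.2 (Set.pair_subset hpI hsI)) (ht s hs)
  exact Ideal.exists_pow_le_of_le_radical_of_fg (Ideal.span_le.2 (Set.pair_subset hpI htI))
    (Submodule.fg_span (Set.toFinite _))

end Finite

variable [Module.FinitePresentation A M]

theorem exists_pow_smul_eq_zero_of_mem_ker (hp : IsValuativePrime p) (hP : IsFreeLattice p P) :
    ∃ n : ℕ, ∀ x ∈ LinearMap.ker f, p ^ n • x = 0 := by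
  have := hp.finitePresentation_range f hP
  have hfg := Module.FinitePresentation.fg_ker _ f.surjective_rangeRestrict
  rw [LinearMap.ker_rangeRestrict] at hfg
  refine exists_forall_pow_smul_mem_of_fg (P := ⊥) hfg fun x hx => ?_
  obtain ⟨n, hn⟩ := IsLocalizedModule.Away.exists_of_eq (f := f) p (hx.trans (map_zero f).symm)
  exact ⟨n, hn.trans (smul_zero _)⟩

theorem isPerfectModule_of_isFreeLattice (hp : IsValuativePrime p) (hP : IsFreeLattice p P)
    (f : M →ₗ[A] L) [IsLocalizedModule (Submonoid.powers p) f] : IsPerfectModule A M := by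
  have := hp.finitePresentation_range f hP
  have hL := (Module.End.isUnit_iff _).1 (IsLocalizedModule.Away.isUnit_algebraMap f p)
  obtain ⟨n, hn⟩ := hp.exists_pow_smul_eq_zero_of_mem_ker f hP
  exact hp.isPerfectModule_of_pow_smul_ker_eq_zero (.submodule _ _ hL.1) f.rangeRestrict
    f.surjective_rangeRestrict fun x hx => hn x (congrArg Subtype.val hx)

theorem isPerfectModule_ker (hp : IsValuativePrime p) (hP : IsFreeLattice p P) :
    IsPerfectModule A (LinearMap.ker f) := by
  have := hp.finitePresentation_range f hP
  have hL := (Module.End.isUnit_iff _).1 (IsLocalizedModule.Away.isUnit_algebraMap f p)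
  have := hp.finitePresentation_ker (.submodule _ _ hL.1) f.rangeRestrict f.surjective_rangeRestrict
  rw [LinearMap.ker_rangeRestrict] at this
  obtain ⟨n, hn⟩ := hp.exists_pow_smul_eq_zero_of_mem_ker f hP
  exact hp.isPerfectModule_of_pow_smul_eq_zero fun x => Subtype.ext (hn x x.2)

end IsValuativePrime

end TorsionFreeSequence

end Lattices

section Functors

universe v₁ u₁

variable {A : Type u} [CommRing A]

section KernelCokernel

variable {𝒞 : Type u₁} [Category.{v₁} 𝒞] {F G : 𝒞 ⥤ ModuleCat.{w} A}

theorem hom_naturality_apply (j : F ⟶ G) {X Y : 𝒞} (f : X ⟶ Y) (x : F.obj X) :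
    (j.app Y).hom ((F.map f).hom x) = (G.map f).hom ((j.app X).hom x) :=
  LinearMap.congr_fun (congrArg ModuleCat.Hom.hom (j.naturality f)) x

/-- The objectwise kernel of a natural transformation of module-valued functors, on explicit
submodules. -/
def kernelFunctor (j : F ⟶ G) : 𝒞 ⥤ ModuleCat.{w} A where
  obj X := ModuleCat.of A (LinearMap.ker (j.app X).hom)
  map f := ModuleCat.ofHom <| (F.map f).hom.restrict fun x hx => by
    rw [LinearMap.mem_ker, hom_naturality_apply, hx, map_zero]
  map_id X := ModuleCat.hom_ext <| LinearMap.ext fun x => Subtype.ext <|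
    LinearMap.congr_fun (congrArg ModuleCat.Hom.hom (F.map_id X)) x.1
  map_comp f g := ModuleCat.hom_ext <| LinearMap.ext fun x => Subtype.ext <|
    LinearMap.congr_fun (congrArg ModuleCat.Hom.hom (F.map_comp f g)) x.1

/-- The inclusion of the objectwise kernel. -/
def kernelInclusion (j : F ⟶ G) : kernelFunctor j ⟶ F where
  app X := ModuleCat.ofHom (LinearMap.ker (j.app X).hom).subtype

/-- The objectwise cokernel of a natural transformation of module-valued functors, on explicit
quotients. -/
def cokernelFunctor (j : F ⟶ G) : 𝒞 ⥤ ModuleCat.{w} A where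
  obj X := ModuleCat.of A (G.obj X ⧸ LinearMap.range (j.app X).hom)
  map {X Y} f := ModuleCat.ofHom <| Submodule.mapQ _ _ (G.map f).hom <| by
    rintro _ ⟨x, rfl⟩
    exact ⟨(F.map f).hom x, hom_naturality_apply j f x⟩
  map_id X := by
    ext x
    simp
  map_comp f g := by
    ext x
    simp

/-- The projection to the objectwise cokernel. -/
def cokernelProjection (j : F ⟶ G) : G ⟶ cokernelFunctor j where
  app X := ModuleCat.ofHom (LinearMap.range (j.app X).hom).mkQ

end KernelCokernel

variable {p : A} (hp : Prime p)

section Saturation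

variable {M₀ M₁ M₂ : Type*} [AddCommGroup M₀] [Module A M₀] [AddCommGroup M₁] [Module A M₁]
  [AddCommGroup M₂] [Module A M₂] {L₀ L₁ L₂ : Type*} [AddCommGroup L₀] [Module A L₀]
  [AddCommGroup L₁] [Module A L₁] [AddCommGroup L₂] [Module A L₂]
  (f₀ : M₀ →ₗ[A] L₀) [IsLocalizedModule (Submonoid.powers p) f₀]
  (f₁ : M₁ →ₗ[A] L₁) [IsLocalizedModule (Submonoid.powers p) f₁]
  (f₂ : M₂ →ₗ[A] L₂) [IsLocalizedModule (Submonoid.powers p) f₂]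

/-- The restriction of `g[1/p] : M₀[1/p] → M₁[1/p]` to the saturations of the images of `M₀` and
`M₁`. -/
noncomputable def saturationMap (g : M₀ →ₗ[A] M₁) :
    saturationOutside hp (LinearMap.range f₀) →ₗ[A] saturationOutside hp (LinearMap.range f₁) :=
  (IsLocalizedModule.map (Submonoid.powers p) f₀ f₁ g).restrict <| by
    rintro x ⟨s, hs, y, hy⟩
    exact ⟨s, hs, g y, by rw [← map_smul, ← hy, IsLocalizedModule.map_apply]⟩

theorem saturationMap_id : saturationMap hp f₀ f₀ LinearMap.id = LinearMap.id :=
  LinearMap.ext fun x => Subtype.ext <|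
    LinearMap.congr_fun (IsLocalizedModule.map_id (Submonoid.powers p) f₀) x.1

theorem saturationMap_comp (g : M₀ →ₗ[A] M₁) (h : M₁ →ₗ[A] M₂) :
    saturationMap hp f₀ f₂ (h ∘ₗ g) = saturationMap hp f₁ f₂ h ∘ₗ saturationMap hp f₀ f₁ g :=
  LinearMap.ext fun x => Subtype.ext <|
    LinearMap.congr_fun (IsLocalizedModule.map_comp' (Submonoid.powers p) f₀ f₁ f₂ g h) x.1

theorem saturationMap_toSaturationOutside (g : M₀ →ₗ[A] M₁) (x : M₀) :
    saturationMap hp f₀ f₁ g (toSaturationOutside hp f₀ x) = toSaturationOutside hp f₁ (g x) :=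
  Subtype.ext (IsLocalizedModule.map_apply (Submonoid.powers p) f₀ f₁ g x)

end Saturation

/-- The functor `M ↦ M_free`, the saturation of the image of `M` in `M[1/p]`. -/
noncomputable def saturationFunctor : ModuleCat.{max u v} A ⥤ ModuleCat.{max u v} A where
  obj M := ModuleCat.of A <|
    saturationOutside hp (LinearMap.range (LocalizedModule.mkLinearMap (Submonoid.powers p) M))
  map g := ModuleCat.ofHom (saturationMap hp _ _ g.hom)
  map_id _ := ModuleCat.hom_ext (saturationMap_id hp _)
  map_comp g h := ModuleCat.hom_ext (saturationMap_comp hp _ _ _ g.hom h.hom)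

/-- The natural map `M → M_free`. -/
noncomputable def toSaturation : 𝟭 (ModuleCat.{max u v} A) ⟶ saturationFunctor.{u, v} hp where
  app M := ModuleCat.ofHom <|
    toSaturationOutside hp (LocalizedModule.mkLinearMap (Submonoid.powers p) M)
  naturality _ _ g := ModuleCat.hom_ext <| LinearMap.ext fun x =>
    (saturationMap_toSaturationOutside hp _ _ g.hom x).symm

end Functors

section Tilt

section Untilt

variable {O : Type u} [CommRing O] [IsDomain O] [IsIntegrallyClosed O] {p : ℕ} [Fact p.Prime]

theorem perfection_dvd_iff {x y : Perfection O p} :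
    x ∣ y ↔ Perfection.coeffMonoidHom O p 0 x ∣ Perfection.coeffMonoidHom O p 0 y := by
  have hp (n : ℕ) : p ^ n ≠ 0 := pow_ne_zero n (Fact.out : p.Prime).ne_zero
  have hroot (z : Perfection O p) (n : ℕ) :
      Perfection.coeffMonoidHom O p n z ^ p ^ n = Perfection.coeffMonoidHom O p 0 z := by
    rw [← Perfection.coeffMonoidHom_pow_p_pow' z 0 n, zero_add]
  refine ⟨map_dvd _, fun h => ?_⟩
  have hdvd (n : ℕ) : Perfection.coeffMonoidHom O p n x ∣ Perfection.coeffMonoidHom O p n y := by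
    rwa [← IsIntegrallyClosed.pow_dvd_pow_iff (hp n), hroot, hroot]
  choose z hz using hdvd
  obtain hx | hx := eq_or_ne (Perfection.coeffMonoidHom O p 0 x) 0
  · have hx (n : ℕ) : Perfection.coeffMonoidHom O p n x = 0 :=
      eq_zero_of_pow_eq_zero ((hroot x n).trans hx)
    exact dvd_of_eq (Perfection.extMonoid fun n => by rw [hz, hx, zero_mul])
  · have hx (n : ℕ) : Perfection.coeffMonoidHom O p n x ≠ 0 := fun h => hx <| by
      rw [← hroot x n, h, zero_pow (hp n)]
    refine ⟨⟨z, fun n => mul_left_cancel₀ (hx n) ?_⟩, Perfection.extMonoid hz⟩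
    rw [← hz, ← Perfection.coeffMonoidHom_pow_p' x, ← Perfection.coeffMonoidHom_pow_p' y, hz,
      mul_pow]

variable [Fact (¬ IsUnit (p : O))] [IsAdicComplete (Ideal.span {(p : O)}) O] {x y : PreTilt O p}

theorem untilt_dvd_untilt_iff : PreTilt.untilt x ∣ PreTilt.untilt y ↔ x ∣ y := by
  let e : Perfection O p ≃* PreTilt O p := Perfection.quotientMulEquiv p (Ideal.span {(p : O)})
  have he (z : PreTilt O p) : Perfection.coeffMonoidHom O p 0 (e.symm z) = PreTilt.untilt z :=
    Perfection.coeff_zero_symm_quotientMulEquiv z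
  rw [← he, ← he, ← perfection_dvd_iff, map_dvd_iff]

theorem untilt_eq_zero_iff : PreTilt.untilt x = 0 ↔ x = 0 := by
  have h : PreTilt.untilt (0 : PreTilt O p) = 0 := Perfection.teichmuller_zero
  rw [← zero_dvd_iff, ← h, untilt_dvd_untilt_iff, zero_dvd_iff]

theorem isUnit_untilt_iff : IsUnit (PreTilt.untilt x) ↔ IsUnit x := by
  rw [isUnit_iff_dvd_one, ← map_one (PreTilt.untilt (O := O) (p := p)), untilt_dvd_untilt_iff,
    isUnit_iff_dvd_one]

variable (O p) in
theorem isDomain_preTilt : IsDomain (PreTilt O p) := by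
  have : NoZeroDivisors (PreTilt O p) :=
    ⟨fun h => by
      simpa only [← untilt_eq_zero_iff, map_mul, mul_eq_zero] using h⟩
  have : Nontrivial (PreTilt O p) :=
    ⟨0, 1, fun h => by
      simpa only [untilt_eq_zero_iff.2 rfl, map_one, zero_ne_one] using congrArg PreTilt.untilt h⟩
  exact NoZeroDivisors.to_isDomain _

variable (O p) in
theorem preValuationRing_preTilt [PreValuationRing O] : PreValuationRing (PreTilt O p) :=
  PreValuationRing.iff_dvd_total.2 ⟨fun x y => by
    simpa only [untilt_dvd_untilt_iff] using ValuationRing.dvd_total x.untilt y.untilt⟩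

end Untilt

namespace IntegerRing

variable {C : Type u} [NormedField C] [IsUltrametricDist C]

theorem mem_iff {x : C} : x ∈ IntegerRing C ↔ ‖x‖ ≤ 1 := by
  rw [Valuation.mem_valuationSubring_iff, NormedField.valuation_apply, ← NNReal.coe_le_coe]
  rfl

theorem norm_le_one (x : IntegerRing C) : ‖(x : C)‖ ≤ 1 :=
  mem_iff.1 x.2

theorem dvd_iff {x y : IntegerRing C} : x ∣ y ↔ ‖(y : C)‖ ≤ ‖(x : C)‖ := by
  constructor
  · rintro ⟨z, rfl⟩
    rw [MulMemClass.coe_mul, norm_mul]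
    exact mul_le_of_le_one_right (norm_nonneg _) (norm_le_one z)
  · intro h
    obtain rfl | hx := eq_or_ne x 0
    · rw [ZeroMemClass.coe_zero, norm_zero] at h
      exact (Subtype.ext (norm_le_zero_iff.1 h) : y = 0) ▸ dvd_rfl
    · have hx : (x : C) ≠ 0 := fun h => hx (Subtype.ext h)
      refine ⟨⟨y / x, mem_iff.2 ?_⟩, Subtype.ext (mul_div_cancel₀ _ hx).symm⟩
      rw [norm_div]
      exact div_le_one_of_le₀ h (norm_nonneg _)

theorem norm_lt_one_of_not_isUnit {x : IntegerRing C} (hx : ¬ IsUnit x) : ‖(x : C)‖ < 1 := by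
  refine (norm_le_one x).lt_of_ne fun h => hx (isUnit_of_dvd_one (dvd_iff.2 ?_))
  rw [h, OneMemClass.coe_one, norm_one]

theorem exists_dvd_pow {x y : IntegerRing C} (hx : x ≠ 0) (hy : ¬ IsUnit y) : ∃ k, x ∣ y ^ k := by
  have hx' : 0 < ‖(x : C)‖ := norm_pos_iff.2 fun h => hx (Subtype.ext h)
  obtain ⟨k, hk⟩ := exists_pow_lt_of_lt_one hx' (norm_lt_one_of_not_isUnit hy)
  exact ⟨k, dvd_iff.2 (by rw [SubmonoidClass.coe_pow, norm_pow]; exact hk.le)⟩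

theorem sModEq_span_pow_iff {a x y : IntegerRing C} {n : ℕ} :
    x ≡ y [SMOD (Ideal.span {a} ^ n • ⊤ : Submodule (IntegerRing C) (IntegerRing C))] ↔
      ‖(x : C) - y‖ ≤ ‖(a : C)‖ ^ n := by
  rw [SModEq.sub_mem, smul_eq_mul, Ideal.mul_top, Ideal.span_singleton_pow,
    Ideal.mem_span_singleton, dvd_iff, SubmonoidClass.coe_pow, norm_pow]
  rfl

theorem isAdicComplete_span [CompleteSpace C] {a : IntegerRing C} (ha : ¬ IsUnit a) :
    IsAdicComplete (Ideal.span {a}) (IntegerRing C) := by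
  have htend := tendsto_pow_atTop_nhds_zero_of_lt_one (norm_nonneg _) (norm_lt_one_of_not_isUnit ha)
  refine { haus' := fun x hx => ?_, prec' := fun f hf => ?_ }
  · refine Subtype.ext (norm_le_zero_iff.1 (ge_of_tendsto' htend fun n => ?_))
    simpa only [ZeroMemClass.coe_zero, sub_zero] using sModEq_span_pow_iff.1 (hx n)
  · have hf' {m n : ℕ} (h : m ≤ n) : ‖(f m : C) - f n‖ ≤ ‖(a : C)‖ ^ m :=
      sModEq_span_pow_iff.1 (hf h)
    have hcauchy : CauchySeq fun n => (f n : C) :=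
      cauchySeq_of_le_tendsto_0' _ (fun n m h => by rw [dist_eq_norm]; exact hf' h) htend
    obtain ⟨l, hl⟩ := cauchySeq_tendsto_of_complete hcauchy
    refine ⟨⟨l, mem_iff.2 (le_of_tendsto' hl.norm fun n => norm_le_one _)⟩, fun n => ?_⟩
    rw [sModEq_span_pow_iff]
    exact le_of_tendsto (hl.const_sub _).norm
      (Filter.eventually_atTop.2 ⟨n, fun m hm => hf' hm⟩)

instance isAdicComplete_span_natCast [CompleteSpace C] (p : ℕ)
    [CharP (IsLocalRing.ResidueField (IntegerRing C)) p] :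
    IsAdicComplete (Ideal.span {(p : IntegerRing C)}) (IntegerRing C) :=
  isAdicComplete_span Fact.out

end IntegerRing

section Witt

variable {p : ℕ} [Fact p.Prime] {R : Type u} [CommRing R] [CharP R p] [PerfectRing R p]

theorem natCast_dvd_iff_coeff_zero_eq_zero {x : WittVector p R} :
    (p : WittVector p R) ∣ x ↔ x.coeff 0 = 0 := by
  rw [← Ideal.mem_span_singleton, WittVector.mem_span_p_iff_coeff_zero_eq_zero]

theorem mem_radical_span_natCast_of_coeff_zero_dvd_pow {s t : WittVector p R} {k : ℕ}
    (h : s.coeff 0 ∣ t.coeff 0 ^ k) : t ∈ (Ideal.span {(p : WittVector p R), s}).radical := by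
  obtain ⟨c, hc⟩ := h
  have hdvd : (p : WittVector p R) ∣ t ^ k - s * WittVector.teichmuller p c := by
    rw [natCast_dvd_iff_coeff_zero_eq_zero, ← WittVector.constantCoeff_apply, map_sub, map_mul,
      map_pow, WittVector.constantCoeff_apply, WittVector.constantCoeff_apply,
      WittVector.constantCoeff_apply, WittVector.teichmuller_coeff_zero, hc, sub_self]
  refine ⟨k, ?_⟩
  rw [← sub_add_cancel (t ^ k) (s * WittVector.teichmuller p c)]
  exact add_mem (Ideal.mem_of_dvd _ hdvd (Ideal.subset_span (by simp)))
    (Ideal.mul_mem_right _ _ (Ideal.subset_span (by simp)))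

variable (p R) in
theorem isValuativePrime_natCast_wittVector [IsDomain R] [PreValuationRing R] :
    IsValuativePrime (p : WittVector p R) where
  prime := by
    rw [← Ideal.span_singleton_prime (WittVector.p_nonzero p R),
      ← Ideal.Quotient.isDomain_iff_prime]
    exact WittVector.quotientPEquiv.toMulEquiv.isDomain
  mem_jacobson_bot := IsAdicComplete.le_jacobson_bot _ (Ideal.mem_span_singleton_self _)
  isHausdorff := inferInstance
  preValuationRing := Function.Surjective.preValuationRing
    (WittVector.quotientPEquiv (p := p) (k := R)).symm.toMulEquiv.toMulHom
    WittVector.quotientPEquiv.symm.surjective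

end Witt

namespace Ainf

variable {p : ℕ} [Fact p.Prime] {C : Type u} [NormedField C] [IsUltrametricDist C]
  [CompleteSpace C] [CharP (IsLocalRing.ResidueField (IntegerRing C)) p]

instance : IsDomain (TiltRing p C) :=
  isDomain_preTilt _ p

instance : PreValuationRing (TiltRing p C) :=
  preValuationRing_preTilt _ p

theorem mem_radical_span_natCast {s t : Ainf p C} (ht : ¬ IsUnit (t.coeff 0))
    (hs : ¬ (p : Ainf p C) ∣ s) : t ∈ (Ideal.span {(p : Ainf p C), s}).radical := by
  rw [natCast_dvd_iff_coeff_zero_eq_zero, ← untilt_eq_zero_iff] at hs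
  rw [← isUnit_untilt_iff] at ht
  obtain ⟨k, hk⟩ := IntegerRing.exists_dvd_pow hs ht
  rw [← map_pow, untilt_dvd_untilt_iff] at hk
  exact mem_radical_span_natCast_of_coeff_zero_dvd_pow hk

end Ainf

end Tilt

theorem mainTheorem9_general {A : Type u} [CommRing A] [IsDomain A] {p : A}
    (hp : IsValuativePrime p) :
    (∀ (M : Type v) [AddCommGroup M] [Module A M],
      Module.FinitePresentation A M →
      Module.Finite (Localization.Away p) (LocalizedModule (Submonoid.powers p) M) →
      Module.Free (Localization.Away p) (LocalizedModule (Submonoid.powers p) M) →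
      IsPerfectModule A M) ∧
    (∃ (Tor Fr Bar : (IsFinPresFreeAway.{u, max u v} A p).FullSubcategory ⥤
          ModuleCat.{max u v} A)
        (i : Tor ⟶ (IsFinPresFreeAway.{u, max u v} A p).ι)
        (j : (IsFinPresFreeAway.{u, max u v} A p).ι ⟶ Fr)
        (q : Fr ⟶ Bar),
      ∀ M : (IsFinPresFreeAway.{u, max u v} A p).FullSubcategory,
        (Function.Injective (i.app M).hom ∧
          Function.Exact (i.app M).hom (j.app M).hom ∧
          Function.Exact (j.app M).hom (q.app M).hom ∧
          Function.Surjective (q.app M).hom) ∧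
        (IsPerfectModule A (Tor.obj M) ∧ ∃ n : ℕ, ∀ x : Tor.obj M, p ^ n • x = 0) ∧
        (Module.Finite A (Fr.obj M) ∧ Module.Free A (Fr.obj M)) ∧
        (IsPerfectModule A (Bar.obj M) ∧
          ∀ t : A, (∀ s, ¬ p ∣ s → t ∈ (Ideal.span {p, s}).radical) →
            ∃ n : ℕ, Ideal.span {p, t} ^ n ≤ Module.annihilator A (Bar.obj M))) ∧
    (∀ (N : Type v) [AddCommGroup N] [Module (Localization.Away p) N],
      Module.Finite (Localization.Away p) N → Module.Projective (Localization.Away p) N →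
      Module.Finite (Localization.Away p) N ∧ Module.Free (Localization.Away p) N) := by
  refine ⟨fun M _ _ _ _ _ => ?_, ?_, fun N _ _ _ _ => ?_⟩
  · obtain ⟨P, hP⟩ := hp.exists_isFreeLattice_localizedModule M
    exact hp.isPerfectModule_of_isFreeLattice hP (LocalizedModule.mkLinearMap _ M)
  · let j := Functor.whiskerLeft (IsFinPresFreeAway.{u, max u v} A p).ι
      (toSaturation.{u, v} hp.prime)
    refine ⟨_, _, _, kernelInclusion j, j, cokernelProjection j, ?_⟩
    rintro ⟨M, _, _, _⟩
    obtain ⟨P, hP⟩ := hp.exists_isFreeLattice_localizedModule M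
    let f := LocalizedModule.mkLinearMap (Submonoid.powers p) M
    have hker := ker_toSaturationOutside hp.prime f
    obtain ⟨n, hn⟩ := hp.exists_pow_smul_eq_zero_of_mem_ker f hP
    have htor := hp.isPerfectModule_ker f hP
    rw [← hker] at hn htor
    exact ⟨⟨Submodule.subtype_injective _, LinearMap.exact_subtype_ker_map _,
        LinearMap.exact_map_mkQ_range _, Submodule.mkQ_surjective _⟩,
      ⟨htor, n, fun x => Subtype.ext (hn x.1 x.2)⟩,
      ⟨hp.finite_saturationOutside_range f hP, hp.free_saturationOutside_range f hP⟩,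
      hp.isPerfectModule_quotient_range_toSaturationOutside f hP,
      fun _ => hp.exists_span_pow_le_annihilator_quotient f hP⟩
  · exact ⟨inferInstance, hp.free_of_projective_away (Localization.Away p) N⟩

theorem mainTheorem9 (p : ℕ) [Fact p.Prime] (C : Type u) [NormedField C] [IsUltrametricDist C]
    [CompleteSpace C] [IsAlgClosed C] [CharZero C]
    [CharP (IsLocalRing.ResidueField (IntegerRing C)) p] :
    -- finitely presented modules that are finite free after inverting `p` are perfect
    (∀ (M : Type v) [AddCommGroup M] [Module (Ainf p C) M],
      Module.FinitePresentation (Ainf p C) M →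
      Module.Finite (AinfInvP p C)
        (LocalizedModule (Submonoid.powers (p : Ainf p C)) M) →
      Module.Free (AinfInvP p C)
        (LocalizedModule (Submonoid.powers (p : Ainf p C)) M) →
      IsPerfectModule (Ainf p C) M) ∧
    -- the functorial exact sequence `0 → M_tor → M → M_free → M̄ → 0`
    (∃ (Tor Fr Bar : (IsFinPresFreeAway.{u, max u v} (Ainf p C)
          (p : Ainf p C)).FullSubcategory ⥤ ModuleCat.{max u v} (Ainf p C))
        (i : Tor ⟶ (IsFinPresFreeAway.{u, max u v} (Ainf p C) (p : Ainf p C)).ι)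
        (j : (IsFinPresFreeAway.{u, max u v} (Ainf p C) (p : Ainf p C)).ι ⟶ Fr)
        (q : Fr ⟶ Bar),
      ∀ M : (IsFinPresFreeAway.{u, max u v} (Ainf p C) (p : Ainf p C)).FullSubcategory,
        (Function.Injective (i.app M).hom ∧
          Function.Exact (i.app M).hom (j.app M).hom ∧
          Function.Exact (j.app M).hom (q.app M).hom ∧
          Function.Surjective (q.app M).hom) ∧
        (IsPerfectModule (Ainf p C) (Tor.obj M) ∧
          ∃ n : ℕ, ∀ x : Tor.obj M, (p : Ainf p C) ^ n • x = 0) ∧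
        (Module.Finite (Ainf p C) (Fr.obj M) ∧ Module.Free (Ainf p C) (Fr.obj M)) ∧
        (IsPerfectModule (Ainf p C) (Bar.obj M) ∧
          ∀ t : Ainf p C, t.coeff 0 ≠ 0 → ¬ IsUnit (t.coeff 0) →
            ∃ n : ℕ, Ideal.span {(p : Ainf p C), t} ^ n ≤
              Module.annihilator (Ainf p C) (Bar.obj M))) ∧
    -- finite projective modules over `𝔸_inf[1/p]` are finite free
    (∀ (N : Type v) [AddCommGroup N] [Module (AinfInvP p C) N],
      Module.Finite (AinfInvP p C) N → Module.Projective (AinfInvP p C) N →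
      Module.Finite (AinfInvP p C) N ∧ Module.Free (AinfInvP p C) N) := by
  obtain ⟨hperf, ⟨Tor, Fr, Bar, i, j, q, hseq⟩, hfree⟩ := mainTheorem9_general.{u, v}
    (isValuativePrime_natCast_wittVector p (TiltRing p C))
  refine ⟨hperf, ⟨Tor, Fr, Bar, i, j, q, fun M => ?_⟩, hfree⟩
  obtain ⟨hexact, htor, hfr, hbar, hann⟩ := hseq M
  exact ⟨hexact, htor, hfr, hbar, fun t _ ht => hann t fun _ => Ainf.mem_radical_span_natCast ht⟩
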